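/- Let $n\ge 0$ and let $p_1\le\dots\le p_n$ and $q_1\ge\dots\ge q_n$ be nonnegative integers such that for each $1\le i<n$ at least one of $p_i<p_{i+1}$, $q_i>q_{i+1}$ holds. Let $x_1,x_2,\dots$ and $y_1,y_2,\dots$ be variables (or any elements of a commutative ring), and set $$a(i)=\frac{\prod_{b=1}^{q_i}(1+y_bT)}{\prod_{a=1}^{p_i}(1-x_aT)}=\sum_{m\ge 0}a(i)_m\,T^m ,\qquad a(i)_m=0\ \text{ for } m<0 .$$ Let $t$ be an integer, let $\lambda_i=q_i-p_i+i+t$ for $1\le i\le n$ (a weakly decreasing sequence), and let $\mu_1\ge\dots\ge\mu_n$ be integers with $\mu_i\le\lambda_i$ for all $i$. The skew diagram $\lambda/\mu$ consists of the boxes $(i,j)$ (row $i$, column $j$) with $1\le i\le n$ and $\mu_i<j\le\lambda_i$; the content of the box $(i,j)$ is $c=j-i-t$. A tableau on $\lambda/\mu$ is a filling of these boxes, each box receiving either a plain positive integer $k$, or a primed positive integer $l'$, or a pair $(k,l')$ of such (a pair contains both a plain entry and a primed entry), such that: 1. in row $i$, every plain entry $k$ satisfies $1\le k\le p_i$ and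 every primed entry $l'$ satisfies $1\le l\le q_i$; 2. a box of content $c$ holds a plain $k$ alone only if $k\le -c$, a primed $l'$ alone only if $l\le c$, and a pair $(k,l')$ only if $l-k=c$; 3. plain entries weakly increase along rows and strictly increase down columns; primed entries strictly increase along rows and weakly increase down columns; 4. every box to the right of or below a box containing a plain (resp. primed) entry contains a plain (resp. primed) entry; 5. the entry immediately to the right of a pair $(k,l')$ has the form $(k+m,(l+m+1)')$, and the entry immediately below it has the form $(k+m+1,(l+m)')$, for some integer $m\ge 0$. The weight of a tableau is the product over its boxes of $x_k$ for an entry $k$, $y_l$ for an entry $l'$, and $x_k+y_l$ for an entry $(k,l')$. Then $$S_{\lambda/\mu}(a(\bullet)):=\det\bigl(a(k)_{\lambda_k-\mu_l+l-k}\bigr)_{1\le k,l\le n}$$ equals the sum of the weights of all tableaux on $\lambda/\mu$. -/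

import Mathlib

/-- The series `∏_{b=1}^{q} (1 + y_b T) / ∏_{a=1}^{p} (1 - x_a T)` in `R⟦T⟧`. -/
noncomputable def chernSeries {R : Type*} [CommRing R] (x y : ℕ → R) (p q : ℕ) :
    PowerSeries R :=
  (∏ b ∈ Finset.Icc 1 q, (1 + PowerSeries.C (y b) * PowerSeries.X)) *
    PowerSeries.invOfUnit
      (∏ a ∈ Finset.Icc 1 p, (1 - PowerSeries.C (x a) * PowerSeries.X)) 1

/-- The quotient in `chernSeries` is a genuine one. -/
theorem chernSeries_mul {R : Type*} [CommRing R] (x y : ℕ → R) (p q : ℕ) :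
    chernSeries x y p q *
        (∏ a ∈ Finset.Icc 1 p, (1 - PowerSeries.C (x a) * PowerSeries.X)) =
      ∏ b ∈ Finset.Icc 1 q, (1 + PowerSeries.C (y b) * PowerSeries.X) := by
  unfold chernSeries
  rw [mul_assoc, PowerSeries.invOfUnit_mul, mul_one]
  simp [map_prod]

/-- The coefficient of `T ^ m` for an integer `m`; it is zero for negative `m`. -/
noncomputable def coeffInt {R : Type*} [CommRing R] (f : PowerSeries R) (m : ℤ) : R :=
  if 0 ≤ m then PowerSeries.coeff m.toNat f else 0

/-- `S_{lam/mu}(a(•)) = det (a(k)_{lam_k - mu_l + l - k})`. -/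
noncomputable def schurDet {R : Type*} [CommRing R] {n : ℕ} (a : Fin n → PowerSeries R)
    (lam mu : Fin n → ℤ) : R :=
  Matrix.det (Matrix.of fun k l : Fin n =>
    coeffInt (a k) (lam k - mu l + ((l : ℕ) : ℤ) - ((k : ℕ) : ℤ)))

/-- The boxes `(i, j)` with `mu i < j ≤ lam i`. Rows are numbered from `0` by `Fin n`
(so `i : Fin n` is row number `i + 1`), columns by integers. -/
noncomputable def skewDiagram {n : ℕ} (lam mu : Fin n → ℤ) : Finset (Fin n × ℤ) :=
  Finset.univ.biUnion fun i => (Finset.Ioc (mu i) (lam i)).image fun j => (i, j)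

theorem mem_skewDiagram {n : ℕ} {lam mu : Fin n → ℤ} {b : Fin n × ℤ} :
    b ∈ skewDiagram lam mu ↔ mu b.1 < b.2 ∧ b.2 ≤ lam b.1 := by
  rcases b with ⟨i, j⟩
  simp [skewDiagram]

/-- The content of a box, `j - i - t` when it lies in row number `i` and column `j`. -/
def content {n : ℕ} (t : ℤ) (b : Fin n × ℤ) : ℤ :=
  b.2 - (((b.1 : ℕ) : ℤ) + 1) - t

/-- What a box may contain: a plain integer `k`, a primed integer `l'`, or a pair `(k, l')`. -/
inductive TabEntry : Type
  | plain (k : ℕ) : TabEntry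
  | primed (l : ℕ) : TabEntry
  | pair (k l : ℕ) : TabEntry

namespace TabEntry

/-- The plain integer occurring in an entry, if there is one. -/
def plainPart : TabEntry → Option ℕ
  | plain k => some k
  | primed _ => none
  | pair k _ => some k

/-- The integer occurring with a prime in an entry, if there is one. -/
def primedPart : TabEntry → Option ℕ
  | plain _ => none
  | primed l => some l
  | pair _ l => some l

/-- `k ↦ x_k`, `l' ↦ y_l`, `(k, l') ↦ x_k + y_l`. -/
def weight {R : Type*} [CommRing R] (x y : ℕ → R) : TabEntry → R
  | plain k => x k
  | primed l => y l
  | pair k l => x k + y l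

/-- The entries that a box of content `c` can hold: a plain `k` with `k ≤ -c`, a primed `l'`
with `l ≤ c`, a pair `(k, l')` with `l - k = c`. -/
def FitsContent (c : ℤ) : TabEntry → Prop
  | plain k => (k : ℤ) ≤ -c
  | primed l => (l : ℤ) ≤ c
  | pair k l => (l : ℤ) - (k : ℤ) = c

end TabEntry

/-- A filling of the boxes of the skew diagram. -/
abbrev Filling {n : ℕ} (lam mu : Fin n → ℤ) : Type :=
  {b : Fin n × ℤ // b ∈ skewDiagram lam mu} → TabEntry

/-- The mixed tableaux on `lam/mu` with flags `p` (plain) and `q` (primed). -/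
structure IsTableau {n : ℕ} (p q : Fin n → ℕ) (t : ℤ) (lam mu : Fin n → ℤ)
    (T : Filling lam mu) : Prop where
  plain_flag : ∀ b, ∀ k ∈ (T b).plainPart, 1 ≤ k ∧ k ≤ p b.1.1
  primed_flag : ∀ b, ∀ l ∈ (T b).primedPart, 1 ≤ l ∧ l ≤ q b.1.1
  fits : ∀ b, (T b).FitsContent (content t b.1)
  /-- A box to the right of one with a plain entry has a plain entry; likewise for primed. -/
  plain_right : ∀ b b', b.1.1 = b'.1.1 → b.1.2 < b'.1.2 →
    (T b).plainPart.isSome → (T b').plainPart.isSome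
  primed_right : ∀ b b', b.1.1 = b'.1.1 → b.1.2 < b'.1.2 →
    (T b).primedPart.isSome → (T b').primedPart.isSome
  /-- A box below one with a plain entry has a plain entry; likewise for primed. -/
  plain_below : ∀ b b', b.1.1 < b'.1.1 → b.1.2 = b'.1.2 →
    (T b).plainPart.isSome → (T b').plainPart.isSome
  primed_below : ∀ b b', b.1.1 < b'.1.1 → b.1.2 = b'.1.2 →
    (T b).primedPart.isSome → (T b').primedPart.isSome
  /-- Plain entries: weakly increasing along rows, strictly increasing down columns. -/
  plain_row : ∀ b b', b.1.1 = b'.1.1 → b.1.2 < b'.1.2 →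
    ∀ k ∈ (T b).plainPart, ∀ k' ∈ (T b').plainPart, k ≤ k'
  plain_col : ∀ b b', b.1.1 < b'.1.1 → b.1.2 = b'.1.2 →
    ∀ k ∈ (T b).plainPart, ∀ k' ∈ (T b').plainPart, k < k'
  /-- Primed entries: strictly increasing along rows, weakly increasing down columns. -/
  primed_row : ∀ b b', b.1.1 = b'.1.1 → b.1.2 < b'.1.2 →
    ∀ l ∈ (T b).primedPart, ∀ l' ∈ (T b').primedPart, l < l'
  primed_col : ∀ b b', b.1.1 < b'.1.1 → b.1.2 = b'.1.2 →
    ∀ l ∈ (T b).primedPart, ∀ l' ∈ (T b').primedPart, l ≤ l'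
  /-- The entry just right of a pair `(k, l')` is a pair `(k + m, (l + m + 1)')`. -/
  pair_right : ∀ b b', b.1.1 = b'.1.1 → b.1.2 + 1 = b'.1.2 →
    ∀ k l, T b = TabEntry.pair k l → ∃ m : ℕ, T b' = TabEntry.pair (k + m) (l + m + 1)
  /-- The entry just below a pair `(k, l')` is a pair `(k + m + 1, (l + m)')`. -/
  pair_below : ∀ b b', (b.1.1 : ℕ) + 1 = (b'.1.1 : ℕ) → b.1.2 = b'.1.2 →
    ∀ k l, T b = TabEntry.pair k l → ∃ m : ℕ, T b' = TabEntry.pair (k + m + 1) (l + m)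

theorem finite_isTableau {n : ℕ} (p q : Fin n → ℕ) (t : ℤ) (lam mu : Fin n → ℤ) :
    {T : Filling lam mu | IsTableau p q t lam mu T}.Finite := by
  have hfin : ∀ P Q : ℕ, {e : TabEntry | (∀ k ∈ e.plainPart, k ≤ P) ∧
      ∀ l ∈ e.primedPart, l ≤ Q}.Finite := by
    intro P Q
    refine ((((Set.finite_Iic P).image TabEntry.plain).union
      ((Set.finite_Iic Q).image TabEntry.primed)).union
      (((Set.finite_Iic P).prod (Set.finite_Iic Q)).image
        fun z => TabEntry.pair z.1 z.2)).subset ?_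
    rintro e ⟨h1, h2⟩
    cases e with
    | plain k => exact Or.inl (Or.inl ⟨k, h1 k rfl, rfl⟩)
    | primed l => exact Or.inl (Or.inr ⟨l, h2 l rfl, rfl⟩)
    | pair k l => exact Or.inr ⟨(k, l), ⟨h1 k rfl, h2 l rfl⟩, rfl⟩
  refine (Set.Finite.pi' (fun b : {b : Fin n × ℤ // b ∈ skewDiagram lam mu} =>
    hfin (p b.1.1) (q b.1.1))).subset ?_
  intro T hT b
  exact ⟨fun k hk => (hT.plain_flag b k hk).2, fun l hl => (hT.primed_flag b l hl).2⟩

/-- The finite set of all tableaux on `lam/mu`. -/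
noncomputable def tableaux {n : ℕ} (p q : Fin n → ℕ) (t : ℤ) (lam mu : Fin n → ℤ) :
    Finset (Filling lam mu) :=
  (finite_isTableau p q t lam mu).toFinset

theorem mem_tableaux {n : ℕ} {p q : Fin n → ℕ} {t : ℤ} {lam mu : Fin n → ℤ}
    {T : Filling lam mu} : T ∈ tableaux p q t lam mu ↔ IsTableau p q t lam mu T := by
  simp [tableaux]

/-- The weight of a filling: the product of the weights of its entries. -/
noncomputable def fillingWeight {R : Type*} [CommRing R] (x y : ℕ → R) {n : ℕ} {lam mu : Fin n → ℤ}
    (T : Filling lam mu) : R :=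
  ∏ b, (T b).weight x y

/-! Each entry is determined by one integer, because its plain part `k` and its primed part `l`
satisfy `l - k = c` and a part that is not positive is simply absent. Subtracting the row number
from `k` turns all monotonicity conditions on tableaux, for plain and primed entries alike, into
the single condition that the resulting map on the boxes is order-preserving, and extending `x` and
`y` by zero to nonpositive indices turns the weight into `x_k + y_l` in every box. So the right-hand
side is the generating function of order-preserving maps bounded by the flags.

Let `k` be the first row with the largest flag. Whether the last box of row `k` attains its bound
gives a recursion: either the flag of row `k` can be lowered by one or the box can be removed. The
determinant obeys the same recursion, by linearity in row `k` and
`a(p, q) = a(p - 1, q - 1) + (x_p + y_q) T a(p, q - 1)`. When row `k` is empty or the next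
row ends in the same column, no filling attains the flag of row `k`, and the determinant with the
box removed vanishes. -/

section MonotoneFillings

variable {β : Type*} [Preorder β] {S : Finset β} {l u u' : β → ℤ} {f : β →₀ ℤ} {a : β}

open Classical in
/-- The order-preserving maps `f : S → ℤ` with `l < f ≤ u`, each extended by zero to all of `β`, so
that maps on different sets `S` live in the same type. -/
noncomputable def monotoneFillings (S : Finset β) (l u : β → ℤ) : Finset (β →₀ ℤ) :=
  {f ∈ S.finsupp fun b => Finset.Ioc (l b) (u b) | MonotoneOn f S}

theorem mem_monotoneFillings :
    f ∈ monotoneFillings S l u ↔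
      (∀ b ∉ S, f b = 0) ∧ (∀ b ∈ S, l b < f b ∧ f b ≤ u b) ∧ MonotoneOn f S := by
  simp only [monotoneFillings, Finset.mem_filter, Finset.mem_finsupp_iff, Finset.mem_Ioc,
    Finset.subset_iff, Finsupp.mem_support_iff, not_imp_comm, and_assoc]

theorem monotoneFillings_empty (l u : β → ℤ) : monotoneFillings ∅ l u = {0} := by
  ext f
  simp [mem_monotoneFillings, DFunLike.ext_iff, Set.subsingleton_empty.monotoneOn]

theorem monotoneFillings_eq_empty {b : β} (hb : b ∈ S) (hul : u b ≤ l b) :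
    monotoneFillings S l u = ∅ :=
  Finset.eq_empty_of_forall_notMem fun f hf => by
    have := (mem_monotoneFillings.1 hf).2.1 b hb
    omega

/-- A bound at `a` is inherited by everything below `a`. -/
theorem monotoneFillings_congr_upper (hu : ∀ b ∈ S, u' b ≤ u b)
    (hu' : ∀ b ∈ S, u b ≤ u' b ∨ ∃ a ∈ S, b ≤ a ∧ u a ≤ u' b) :
    monotoneFillings S l u = monotoneFillings S l u' := by
  ext f
  simp only [mem_monotoneFillings]
  refine ⟨fun ⟨hoff, hbound, hmono⟩ => ⟨hoff, fun b hb => ⟨(hbound b hb).1, ?_⟩, hmono⟩,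
    fun ⟨hoff, hbound, hmono⟩ =>
      ⟨hoff, fun b hb => ⟨(hbound b hb).1, (hbound b hb).2.trans (hu b hb)⟩, hmono⟩⟩
  rcases hu' b hb with h | ⟨a, ha, hba, h⟩
  · exact (hbound b hb).2.trans h
  · exact (hmono hb ha hba).trans ((hbound a ha).2.trans h)

variable [DecidableEq β]

theorem filter_lt_monotoneFillings (ha : a ∈ S) :
    {f ∈ monotoneFillings S l u | f a < u a} =
      monotoneFillings S l (Function.update u a (u a - 1)) := by
  ext f
  simp only [Finset.mem_filter, mem_monotoneFillings, Function.update_apply]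
  grind

theorem erase_mem_monotoneFillings (ha : a ∉ S) (hf : f ∈ monotoneFillings (insert a S) l u) :
    f.erase a ∈ monotoneFillings S l u := by
  rw [mem_monotoneFillings] at hf ⊢
  have heq : Set.EqOn f (f.erase a) S := fun b hb =>
    (Finsupp.erase_ne (ne_of_mem_of_not_mem hb ha)).symm
  refine ⟨fun b hb => ?_, fun b hb => ?_, (hf.2.2.mono (by simp)).congr heq⟩
  · rw [Finsupp.erase_apply]
    grind
  · rw [← heq hb]
    exact hf.2.1 b (Finset.mem_insert_of_mem hb)

theorem update_mem_monotoneFillings (ha : ∀ b ∈ S, ¬ a ≤ b) {v : ℤ} (hv : l a < v ∧ v ≤ u a)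
    (hf : f ∈ monotoneFillings S l u) (hle : ∀ b ∈ S, b ≤ a → f b ≤ v) :
    f.update a v ∈ monotoneFillings (insert a S) l u := by
  have haS : a ∉ S := fun h => ha a h le_rfl
  rw [mem_monotoneFillings] at hf ⊢
  have heq : Set.EqOn f (f.update a v) S := fun b hb => by
    simp [ne_of_mem_of_not_mem hb haS]
  refine ⟨fun b hb => ?_, fun b hb => ?_, ?_⟩
  · rw [Finset.mem_insert, not_or] at hb
    simpa [hb.1] using hf.1 b hb.2
  · rcases Finset.mem_insert.1 hb with rfl | hb
    · simpa using hv
    · rw [← heq hb]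
      exact hf.2.1 b hb
  · rw [Finset.coe_insert, Set.monotoneOn_insert_iff]
    refine ⟨fun b hb hba => ?_, fun b hb hab => absurd hab (ha b hb), hf.2.2.congr heq⟩
    rw [← heq hb]
    simpa using hle b hb hba

/-- The generating function of `monotoneFillings S l u`, where the value `m` at `b` weighs
`w b m`. -/
noncomputable def fillingSum {R : Type*} [CommSemiring R] (w : β → ℤ → R) (S : Finset β)
    (l u : β → ℤ) : R :=
  ∑ f ∈ monotoneFillings S l u, ∏ b ∈ S, w b (f b)

/-- The fillings of `insert a S` are sorted by whether they attain the bound at `a`; those that do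
are determined by their restriction to `S`. -/
theorem fillingSum_insert {R : Type*} [CommSemiring R] (w : β → ℤ → R) (ha : ∀ b ∈ S, ¬ a ≤ b)
    (hlu : l a < u a) (hle : ∀ f ∈ monotoneFillings S l u, ∀ b ∈ S, b ≤ a → f b ≤ u a) :
    fillingSum w (insert a S) l u =
      fillingSum w (insert a S) l (Function.update u a (u a - 1)) +
        w a (u a) * fillingSum w S l u := by
  have haS : a ∉ S := fun h => ha a h le_rfl
  unfold fillingSum
  rw [← filter_lt_monotoneFillings (Finset.mem_insert_self a S),
    ← Finset.sum_filter_add_sum_filter_not (monotoneFillings (insert a S) l u) (fun f => f a < u a),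
    Finset.mul_sum]
  congr 1
  have hattain : ∀ f ∈ {f ∈ monotoneFillings (insert a S) l u | ¬ f a < u a}, f a = u a := by
    intro f hf
    rw [Finset.mem_filter, mem_monotoneFillings] at hf
    exact le_antisymm (hf.1.2.1 a (Finset.mem_insert_self a S)).2 (not_lt.1 hf.2)
  refine Finset.sum_bij' (fun f _ => f.erase a) (fun f _ => f.update a (u a)) ?_ ?_ ?_ ?_ ?_
  · exact fun f hf => erase_mem_monotoneFillings haS (Finset.mem_filter.1 hf).1
  · exact fun f hf => Finset.mem_filter.2
      ⟨update_mem_monotoneFillings ha ⟨hlu, le_rfl⟩ hf (hle f hf), by simp⟩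
  · intro f hf
    simp [← hattain f hf]
  · intro f hf
    ext b
    by_cases hb : b = a <;> simp [hb, (mem_monotoneFillings.1 hf).1 a haS]
  · intro f hf
    rw [Finset.prod_insert haS, hattain f hf]
    refine congrArg _ (Finset.prod_congr rfl fun b hb => ?_)
    rw [Finsupp.erase_ne (ne_of_mem_of_not_mem hb haS)]

end MonotoneFillings

section Lowering

variable {ι : Type*} {f : ι → ℤ} {k : ι}

theorem sub_single_one_apply_le [DecidableEq ι] (f : ι → ℤ) (k i : ι) :
    (f - Pi.single k 1 : ι → ℤ) i ≤ f i := by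
  rcases eq_or_ne i k with rfl | hi <;> simp [*]

theorem sum_sub_single_one [DecidableEq ι] [Fintype ι] (f : ι → ℤ) (k : ι) :
    ∑ i, (f - Pi.single k 1 : ι → ℤ) i = ∑ i, f i - 1 := by
  simp

theorem le_sub_single_one [DecidableEq ι] {g : ι → ℤ} (hgf : g ≤ f) (hk : g k < f k) :
    g ≤ f - Pi.single k 1 := by
  intro i
  have := hgf i
  simp only [Pi.sub_apply, Pi.single_apply]
  grind

theorem antitone_sub_single_one [PartialOrder ι] [DecidableEq ι] (hf : Antitone f)
    (hk : ∀ j > k, f j < f k) : Antitone (f - Pi.single k 1) := by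
  intro i j hij
  rcases hij.eq_or_lt with rfl | hlt
  · exact le_rfl
  have := hf hij
  have := hk j
  simp only [Pi.sub_apply, Pi.single_apply]
  grind

theorem monotone_sub_single_one [PartialOrder ι] [DecidableEq ι] (hf : Monotone f)
    (hk : ∀ j < k, f j < f k) : Monotone (f - Pi.single k 1) := by
  intro i j hij
  rcases hij.eq_or_lt with rfl | hlt
  · exact le_rfl
  have := hf hij
  have := hk i
  simp only [Pi.sub_apply, Pi.single_apply]
  grind

theorem exists_forall_lt_and_forall_ge_eq [LinearOrder ι] [Finite ι] [Nonempty ι]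
    (hf : Monotone f) : ∃ k, (∀ j < k, f j < f k) ∧ ∀ j ≥ k, f j = f k := by
  obtain ⟨m, hm⟩ := Finite.exists_max f
  obtain ⟨k, hk, hmin⟩ := WellFounded.has_min (wellFounded_lt (α := ι)) {j | f j = f m} ⟨m, rfl⟩
  have hk : f k = f m := hk
  exact ⟨k, fun j hj => hk ▸ (hm j).lt_of_ne fun h => hmin j h hj,
    fun j hj => le_antisymm (hk ▸ hm j) (hf hj)⟩

theorem exists_succ_eq_of_not_antitone_sub_single_one {n : ℕ} {f : Fin n → ℤ} {k : Fin n}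
    (hf : Antitone f) (hk : ¬ Antitone (f - Pi.single k 1)) :
    ∃ j : Fin n, (j : ℕ) = k + 1 ∧ f j = f k := by
  contrapose! hk
  refine antitone_sub_single_one hf fun j hj => ?_
  have hkj : (k : ℕ) + 1 ≤ j := hj
  let s : Fin n := ⟨k + 1, by omega⟩
  have hks : k ≤ s := Fin.le_def.2 (Nat.le_succ k)
  exact (hf (show s ≤ j from hkj)).trans_lt ((hf hks).lt_of_ne (hk s rfl))

end Lowering

section FlaggedSum

variable {R : Type*} [CommSemiring R] {n : ℕ} {w : ℤ → ℤ → R} {L t : ℤ} {p lam mu : Fin n → ℤ}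
  {k : Fin n}

/-- The bound that the flags `p` put on order-preserving fillings, in which row `i` is lowered
by `i`. -/
def rowBound (p : Fin n → ℤ) (b : Fin n × ℤ) : ℤ :=
  p b.1 - (b.1 : ℕ)

/-- The generating function of the fillings `g` of `lam/mu` with `L < g (i, j) ≤ p i` that weakly
increase along rows and strictly increase down columns, where `g b` weighs `w (g b) c` in a box of
content `c`. They are encoded by the order-preserving maps `(i, j) ↦ g (i, j) - i`. -/
noncomputable def flaggedSum (w : ℤ → ℤ → R) (L t : ℤ) (p lam mu : Fin n → ℤ) : R :=
  fillingSum (fun b m => w (m + (b.1 : ℕ)) (content t b)) (skewDiagram lam mu)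
    (rowBound fun _ => L) (rowBound p)

theorem skewDiagram_self (lam : Fin n → ℤ) : skewDiagram lam lam = ∅ := by
  ext b
  simp [mem_skewDiagram]

theorem skewDiagram_eq_insert (hk : mu k < lam k) :
    skewDiagram lam mu = insert (k, lam k) (skewDiagram (lam - Pi.single k 1) mu) := by
  ext ⟨i, j⟩
  simp only [Finset.mem_insert, mem_skewDiagram, Prod.mk.injEq, Pi.sub_apply, Pi.single_apply]
  grind

theorem flaggedSum_of_forall_eq (hle : mu ≤ lam) (hp : ∀ i, p i = L) :
    flaggedSum w L t p lam mu = if lam = mu then 1 else 0 := by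
  unfold flaggedSum fillingSum
  split_ifs with h
  · simp [h, skewDiagram_self, monotoneFillings_empty]
  · obtain ⟨i, hi⟩ := Function.ne_iff.1 h
    have hb : (i, lam i) ∈ skewDiagram lam mu :=
      mem_skewDiagram.2 ⟨(hle i).lt_of_ne' hi, le_rfl⟩
    rw [monotoneFillings_eq_empty hb (by simp [rowBound, hp]), Finset.sum_empty]

/-- If no filling attains the flag of row `k`, that flag can be lowered. -/
theorem flaggedSum_sub_single_of_forall_exists
    (h : ∀ j, (k, j) ∈ skewDiagram lam mu →
      ∃ a ∈ skewDiagram lam mu, (k, j) ≤ a ∧ rowBound p a < rowBound p (k, j)) :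
    flaggedSum w L t p lam mu = flaggedSum w L t (p - Pi.single k 1) lam mu := by
  unfold flaggedSum fillingSum
  rw [monotoneFillings_congr_upper]
  · exact fun b _ => sub_le_sub_right (sub_single_one_apply_le p k b.1) _
  · rintro ⟨i, j⟩ hb
    rcases eq_or_ne i k with rfl | hi
    · obtain ⟨a, ha, hba, hlt⟩ := h j hb
      refine Or.inr ⟨a, ha, hba, ?_⟩
      simp only [rowBound, Pi.sub_apply, Pi.single_eq_same] at hlt ⊢
      omega
    · simp [rowBound, hi]

theorem flaggedSum_of_row_empty (hk : mu k = lam k) :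
    flaggedSum w L t p lam mu = flaggedSum w L t (p - Pi.single k 1) lam mu :=
  flaggedSum_sub_single_of_forall_exists fun j hj => by
    rw [mem_skewDiagram] at hj
    simp only [hk] at hj
    omega

theorem flaggedSum_of_next_row_eq (hmu : Antitone mu) {k' : Fin n} (hk : (k' : ℕ) = k + 1)
    (hp : p k' = p k) (hlam : lam k' = lam k) :
    flaggedSum w L t p lam mu = flaggedSum w L t (p - Pi.single k 1) lam mu := by
  have hkk : k ≤ k' := Fin.le_def.2 (by omega)
  refine flaggedSum_sub_single_of_forall_exists fun j hj => ⟨(k', j), ?_, ⟨hkk, le_rfl⟩, ?_⟩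
  · rw [mem_skewDiagram] at hj ⊢
    exact ⟨(hmu hkk).trans_lt hj.1, hlam ▸ hj.2⟩
  · simp only [rowBound, hp, hk]
    omega

theorem le_rowBound_of_le_last (hlam : Antitone lam) (hmu : Antitone mu)
    (hpk : ∀ j < k, p j < p k) {f : Fin n × ℤ →₀ ℤ} {l : Fin n × ℤ → ℤ}
    (hf : f ∈ monotoneFillings (skewDiagram (lam - Pi.single k 1) mu) l (rowBound p))
    {b : Fin n × ℤ} (hb : b ∈ skewDiagram (lam - Pi.single k 1) mu) (hbk : b ≤ (k, lam k)) :
    f b ≤ rowBound p (k, lam k) := by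
  obtain ⟨-, hbound, hmono⟩ := mem_monotoneFillings.1 hf
  obtain ⟨i, j⟩ := b
  obtain ⟨hik : i ≤ k, hj : j ≤ lam k⟩ := hbk
  rcases hik.eq_or_lt with rfl | hlt
  · exact (hbound _ hb).2
  let r : Fin n := ⟨k - 1, by omega⟩
  have hrk : r < k := Fin.lt_def.2 (by simp only [r]; omega)
  have hir : i ≤ r := Fin.le_def.2 (by simp only [r]; omega)
  have hr : (r, lam k) ∈ skewDiagram (lam - Pi.single k 1) mu := by
    rw [mem_skewDiagram] at hb ⊢
    simpa [hrk.ne] using ⟨(hmu hir).trans_lt (hb.1.trans_le hj), hlam hrk.le⟩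
  calc f (i, j) ≤ f (r, lam k) := hmono hb hr ⟨hir, hj⟩
    _ ≤ p r - (r : ℕ) := (hbound _ hr).2
    _ ≤ p k - (k : ℕ) := by
      have := hpk r hrk
      simp only [r] at this ⊢
      omega

theorem monotoneFillings_update_rowBound {l : Fin n × ℤ → ℤ} (hk : mu k < lam k) :
    monotoneFillings (skewDiagram lam mu) l
        (Function.update (rowBound p) (k, lam k) (rowBound p (k, lam k) - 1)) =
      monotoneFillings (skewDiagram lam mu) l (rowBound (p - Pi.single k 1)) := by
  refine monotoneFillings_congr_upper ?_ ?_ <;> rintro ⟨i, j⟩ hb <;>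
    simp only [rowBound, Function.update_apply, Pi.sub_apply, Pi.single_apply, Prod.mk.injEq]
  · grind
  · rcases eq_or_ne i k with rfl | hi
    · refine Or.inr ⟨(i, lam i), mem_skewDiagram.2 ⟨hk, le_rfl⟩,
        ⟨le_rfl, (mem_skewDiagram.1 hb).2⟩, ?_⟩
      simp only [if_true]
      omega
    · simp [hi]

theorem flaggedSum_of_removable (hlam : Antitone lam) (hmu : Antitone mu) (hk : mu k < lam k)
    (hrem : Antitone (lam - Pi.single k 1)) (hL : L < p k) (hpk : ∀ j < k, p j < p k) :
    flaggedSum w L t p lam mu = flaggedSum w L t (p - Pi.single k 1) lam mu +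
      w (p k) (content t (k, lam k)) * flaggedSum w L t p (lam - Pi.single k 1) mu := by
  have hlast : ∀ b ∈ skewDiagram (lam - Pi.single k 1) mu, ¬ (k, lam k) ≤ b := by
    rintro b hb ⟨h1 : k ≤ b.1, h2 : lam k ≤ b.2⟩
    have := (mem_skewDiagram.1 hb).2.trans (hrem h1)
    simp only [Pi.sub_apply, Pi.single_eq_same] at this
    omega
  have hsum := fillingSum_insert (fun b m => w (m + (b.1 : ℕ)) (content t b)) hlast
    (l := rowBound fun _ => L) (u := rowBound p) (by simpa [rowBound] using hL)
    fun f hf b hb hbk => le_rowBound_of_le_last hlam hmu hpk hf hb hbk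
  rw [← skewDiagram_eq_insert hk] at hsum
  have hval : rowBound p (k, lam k) + (k : ℕ) = p k := sub_add_cancel _ _
  simpa only [flaggedSum, fillingSum, monotoneFillings_update_rowBound hk, hval] using hsum

end FlaggedSum

section Determinant

variable {R : Type*} [CommRing R]

/-- A permutation cannot avoid too large a block of zeros. -/
theorem det_eq_zero_of_card_lt {ι : Type*} [Fintype ι] [DecidableEq ι] {M : Matrix ι ι R}
    {I J : Finset ι} (hM : ∀ i ∈ I, ∀ j ∈ J, M i j = 0)
    (hcard : Fintype.card ι < I.card + J.card) : M.det = 0 := by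
  rw [Matrix.det_apply]
  refine Finset.sum_eq_zero fun σ _ => ?_
  obtain ⟨j, hj, hσ⟩ : ∃ j ∈ J, σ j ∈ I := by
    by_contra! havoid
    have hle : J.card ≤ Iᶜ.card := Finset.card_le_card_of_injOn σ
      (fun j hj => by simpa using havoid j hj) σ.injective.injOn
    have := I.card_add_card_compl
    omega
  have hprod : ∏ j, M (σ j) j = 0 := Finset.prod_eq_zero (Finset.mem_univ j) (hM _ hσ j hj)
  rw [hprod, smul_zero]

variable {n : ℕ} {w : ℤ → ℤ → R} {h : ℤ → ℤ → ℤ → R} {L C t : ℤ} {p lam mu : Fin n → ℤ}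
  {k : Fin n}

/-- The Jacobi–Trudi matrix of `lam/mu` for the flags `p`. Here `h P c s` plays the role of the
generating function of a row with entries at most `P` whose boxes have the contents
`s + 1, …, c`. -/
def contentMatrix (h : ℤ → ℤ → ℤ → R) (t : ℤ) (p lam mu : Fin n → ℤ) : Matrix (Fin n) (Fin n) R :=
  Matrix.of fun k l => h (p k) (content t (k, lam k)) (content t (l, mu l))

/-- The properties that `h P c s` has as the generating function of the weakly increasing rows with
entries in `L + 1, …, P` and boxes of contents `s + 1, …, c`, where an entry `P` in a box of content
`c` weighs `w P c`: the recursion according to whether the last entry is `P`, and the two boundary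
conditions. The values at `L` are only prescribed for contents up to `C`. -/
structure IsRowGeneratingFunction (w : ℤ → ℤ → R) (L C : ℤ) (h : ℤ → ℤ → ℤ → R) : Prop where
  recurrence : ∀ P c s, h P c s = h (P - 1) c s + w P c * h P (c - 1) s
  lowest : ∀ c ≤ C, ∀ s, h L c s = if c = s then 1 else 0
  eq_zero_of_lt : ∀ P c s, c < s → h P c s = 0

theorem content_sub_one (t : ℤ) (i : Fin n) (j : ℤ) :
    content t (i, j - 1) = content t (i, j) - 1 := by
  simp only [content]
  ring

theorem strictAnti_content (t : ℤ) (hlam : Antitone lam) :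
    StrictAnti fun i => content t (i, lam i) := by
  intro i j hij
  have := hlam hij.le
  have := Fin.lt_def.1 hij
  simp only [content]
  omega

theorem content_sub_single_one_le (t : ℤ) (lam : Fin n → ℤ) (k i : Fin n) :
    content t (i, (lam - Pi.single k 1 : Fin n → ℤ) i) ≤ content t (i, lam i) := by
  have := sub_single_one_apply_le lam k i
  simp only [content]
  omega

theorem det_contentMatrix_row (hh : IsRowGeneratingFunction w L C h) (t : ℤ)
    (p lam mu : Fin n → ℤ) (k : Fin n) :
    (contentMatrix h t p lam mu).det =
      (contentMatrix h t (p - Pi.single k 1) lam mu).det +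
        w (p k) (content t (k, lam k)) *
          (contentMatrix h t p (lam - Pi.single k 1) mu).det := by
  have hsplit : contentMatrix h t p lam mu = (contentMatrix h t p lam mu).updateRow k
      (contentMatrix h t (p - Pi.single k 1) lam mu k +
        w (p k) (content t (k, lam k)) • contentMatrix h t p (lam - Pi.single k 1) mu k) := by
    ext i l
    rcases eq_or_ne i k with rfl | hi
    · simp [contentMatrix, content_sub_one, ← hh.recurrence]
    · simp [hi]
  rw [hsplit, Matrix.det_updateRow_add, Matrix.det_updateRow_smul]
  congr 3 <;> ext i l <;> rcases eq_or_ne i k with rfl | hi <;> simp [contentMatrix, *]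

theorem det_contentMatrix_of_forall_eq (hh : IsRowGeneratingFunction w L C h) (hmu : Antitone mu)
    (hle : mu ≤ lam) (hp : ∀ i, p i = L) (hC : ∀ i, content t (i, lam i) ≤ C) :
    (contentMatrix h t p lam mu).det = if lam = mu then 1 else 0 := by
  have hentry (i j) : contentMatrix h t p lam mu i j =
      if content t (i, lam i) = content t (j, mu j) then 1 else 0 := by
    rw [contentMatrix, Matrix.of_apply, hp, hh.lowest _ (hC i)]
  have hcontent (i) : content t (i, mu i) ≤ content t (i, lam i) :=
    sub_le_sub_right (sub_le_sub_right (hle i) _) _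
  have hlower : (contentMatrix h t p lam mu).IsLowerTriangular := fun i j (hij : i < j) => by
    have hlt : content t (j, mu j) < content t (i, mu i) := strictAnti_content t hmu hij
    rw [hentry, if_neg (hlt.trans_le (hcontent i)).ne']
  rw [Matrix.det_of_isLowerTriangular _ hlower]
  simp [hentry, content, Finset.prod_ite_zero, funext_iff]

theorem det_contentMatrix_sub_single_of_row_empty (hh : IsRowGeneratingFunction w L C h)
    (hlam : Antitone lam) (hmu : Antitone mu) (hk : mu k = lam k) :
    (contentMatrix h t p (lam - Pi.single k 1) mu).det = 0 := by
  refine det_eq_zero_of_card_lt (I := Finset.Ici k) (J := Finset.Iic k) (fun i hi j hj => ?_) ?_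
  · rw [Finset.mem_Ici] at hi
    rw [Finset.mem_Iic] at hj
    refine hh.eq_zero_of_lt _ _ _ ?_
    have hmono : content t (k, mu k) ≤ content t (j, mu j) := (strictAnti_content t hmu).antitone hj
    refine lt_of_lt_of_le ?_ hmono
    rcases hi.eq_or_lt with rfl | hi
    · simp [hk, content_sub_one]
    · rw [hk]
      exact (content_sub_single_one_le t lam k i).trans_lt (strictAnti_content t hlam hi)
  · rw [Fin.card_Ici, Fin.card_Iic, Fintype.card_fin]
    omega

theorem det_contentMatrix_sub_single_of_next_row_eq {k' : Fin n} (hk : (k' : ℕ) = k + 1)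
    (hp : p k' = p k) (hlam : lam k' = lam k) :
    (contentMatrix h t p (lam - Pi.single k 1) mu).det = 0 := by
  have hne : k ≠ k' := fun heq => by simp [heq] at hk
  refine Matrix.det_zero_of_row_eq hne (funext fun l => ?_)
  have hcontent : content t (k, lam k - 1) = content t (k', lam k) := by
    simp only [content, hk]
    push_cast
    ring
  simp [contentMatrix, hne.symm, hp, hlam, hcontent]

/-- The flagged Jacobi–Trudi identity for content-dependent weights. Both sides obey the same
recursion in the first row with maximal flag. -/
theorem det_contentMatrix_eq_flaggedSum (hh : IsRowGeneratingFunction w L C h) (hp : Monotone p)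
    (hlam : Antitone lam) (hmu : Antitone mu) (hle : mu ≤ lam) (hL : ∀ i, L ≤ p i)
    (hC : ∀ i, content t (i, lam i) ≤ C) :
    (contentMatrix h t p lam mu).det = flaggedSum w L t p lam mu := by
  obtain ⟨N, hN⟩ : ∃ N : ℕ, ∑ i, p i + ∑ i, lam i < ∑ _i : Fin n, L + ∑ i, mu i + N :=
    ⟨(∑ i, p i + ∑ i, lam i - (∑ _i : Fin n, L + ∑ i, mu i)).toNat + 1, by omega⟩
  induction N generalizing p lam with
  | zero =>
    have hp' : ∑ _i : Fin n, L ≤ ∑ i, p i := Finset.sum_le_sum fun i _ => hL i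
    have hlam' : ∑ i, mu i ≤ ∑ i, lam i := Finset.sum_le_sum fun i _ => hle i
    omega
  | succ N ih =>
    by_cases hlow : ∀ i, p i = L
    · rw [det_contentMatrix_of_forall_eq hh hmu hle hlow hC, flaggedSum_of_forall_eq hle hlow]
    obtain ⟨i, hi⟩ := not_forall.1 hlow
    have : Nonempty (Fin n) := ⟨i⟩
    obtain ⟨k, hpk, hkp⟩ := exists_forall_lt_and_forall_ge_eq hp
    have hLk : L < p k := ((hL i).lt_of_ne' hi).trans_le <|
      (le_total i k).elim (fun hik => hp hik) fun hki => (hkp i hki).le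
    rw [det_contentMatrix_row hh t p lam mu k,
      ih (monotone_sub_single_one hp hpk) hlam hle
        (le_sub_single_one (g := fun _ => L) hL hLk) hC (by rw [sum_sub_single_one]; omega)]
    rcases (hle k).eq_or_lt with hempty | hlt
    · rw [← flaggedSum_of_row_empty hempty,
        det_contentMatrix_sub_single_of_row_empty hh hlam hmu hempty, mul_zero, add_zero]
    by_cases hrem : Antitone (lam - Pi.single k 1)
    · rw [flaggedSum_of_removable hlam hmu hlt hrem hLk hpk,
        ih hp hrem (le_sub_single_one hle hlt) hL
          (fun i => (content_sub_single_one_le t lam k i).trans (hC i))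
          (by rw [sum_sub_single_one]; omega)]
    · obtain ⟨k', hk', heq⟩ := exists_succ_eq_of_not_antitone_sub_single_one hlam hrem
      have hpk' : p k' = p k := hkp k' (Fin.le_def.2 (by omega))
      rw [flaggedSum_of_next_row_eq hmu hk' hpk' heq,
        det_contentMatrix_sub_single_of_next_row_eq hk' hpk' heq, mul_zero, add_zero]

end Determinant

section Series

variable {R : Type*}

/-- Extension by zero of the variables `x 1, x 2, …` to all integers. The value `x 0` is dropped. -/
def extendZero [Zero R] (x : ℕ → R) (k : ℤ) : R :=
  if 1 ≤ k then x k.toNat else 0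

theorem extendZero_of_nonpos [Zero R] (x : ℕ → R) {k : ℤ} (hk : k ≤ 0) : extendZero x k = 0 :=
  if_neg (by omega)

theorem extendZero_of_pos [Zero R] (x : ℕ → R) {k : ℤ} (hk : 0 < k) :
    extendZero x k = x k.toNat :=
  if_pos hk

theorem prod_Icc_toNat [Zero R] {M : Type*} [CommMonoid M] (x : ℕ → R) {F : R → M} (hF : F 0 = 1)
    (K : ℤ) : ∏ i ∈ Finset.Icc 1 K.toNat, F (x i) =
      (∏ i ∈ Finset.Icc 1 (K - 1).toNat, F (x i)) * F (extendZero x K) := by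
  rcases le_or_gt K 0 with hK | hK
  · rw [extendZero_of_nonpos x hK, hF, mul_one, Int.toNat_of_nonpos hK,
      Int.toNat_of_nonpos (by omega)]
  · have hsucc : K.toNat = (K - 1).toNat + 1 := by omega
    rw [extendZero_of_pos x hK, hsucc, Finset.prod_Icc_succ_top (by omega)]

variable [CommRing R]

theorem eq_chernSeries_of_mul_eq {x y : ℕ → R} {p q : ℕ} {f : PowerSeries R}
    (hf : f * (∏ a ∈ Finset.Icc 1 p, (1 - PowerSeries.C (x a) * PowerSeries.X)) =
      ∏ b ∈ Finset.Icc 1 q, (1 + PowerSeries.C (y b) * PowerSeries.X)) :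
    f = chernSeries x y p q := by
  rw [chernSeries, ← hf, mul_assoc, PowerSeries.mul_invOfUnit _ _ (by simp [map_prod]), mul_one]

theorem chernSeries_zero_zero (x y : ℕ → R) : chernSeries x y 0 0 = 1 :=
  (eq_chernSeries_of_mul_eq (by simp)).symm

theorem chernSeries_toNat_right (x y : ℕ → R) (p : ℕ) (Q : ℤ) :
    chernSeries x y p Q.toNat = chernSeries x y p (Q - 1).toNat *
      (1 + PowerSeries.C (extendZero y Q) * PowerSeries.X) := by
  rw [chernSeries, prod_Icc_toNat y (F := fun r => 1 + PowerSeries.C r * PowerSeries.X) (by simp),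
    mul_right_comm, ← chernSeries]

theorem chernSeries_toNat_left (x y : ℕ → R) (P : ℤ) (q : ℕ) :
    chernSeries x y P.toNat q * (1 - PowerSeries.C (extendZero x P) * PowerSeries.X) =
      chernSeries x y (P - 1).toNat q := by
  apply eq_chernSeries_of_mul_eq
  rw [mul_right_comm, mul_assoc, ← prod_Icc_toNat x
    (F := fun r => 1 - PowerSeries.C r * PowerSeries.X) (by simp), chernSeries_mul]

theorem chernSeries_toNat_eq_add (x y : ℕ → R) (P Q : ℤ) :
    chernSeries x y P.toNat Q.toNat = chernSeries x y (P - 1).toNat (Q - 1).toNat +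
      PowerSeries.C (extendZero x P + extendZero y Q) *
        (chernSeries x y P.toNat (Q - 1).toNat * PowerSeries.X) := by
  rw [chernSeries_toNat_right, ← chernSeries_toNat_left x y P, map_add]
  ring

theorem coeffInt_of_neg (f : PowerSeries R) {m : ℤ} (hm : m < 0) : coeffInt f m = 0 :=
  if_neg (by omega)

theorem coeffInt_add (f g : PowerSeries R) (m : ℤ) :
    coeffInt (f + g) m = coeffInt f m + coeffInt g m := by
  unfold coeffInt
  split_ifs <;> simp

theorem coeffInt_C_mul_mul_X (a : R) (f : PowerSeries R) (m : ℤ) :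
    coeffInt (PowerSeries.C a * (f * PowerSeries.X)) m = a * coeffInt f (m - 1) := by
  rcases lt_trichotomy m 0 with hm | rfl | hm
  · rw [coeffInt_of_neg _ hm, coeffInt_of_neg _ (by omega), mul_zero]
  · simp [coeffInt]
  · have hsucc : m.toNat = (m - 1).toNat + 1 := by omega
    rw [coeffInt, coeffInt, if_pos hm.le, if_pos (by omega), hsucc, PowerSeries.coeff_C_mul,
      PowerSeries.coeff_succ_mul_X]

theorem coeffInt_one (m : ℤ) : coeffInt (1 : PowerSeries R) m = if m = 0 then 1 else 0 := by
  unfold coeffInt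
  rw [PowerSeries.coeff_one]
  split_ifs <;> first | rfl | omega

/-- The coefficient of `T ^ (c - s)` in the series `a` of a row with flags `P` and `P + c`. It is
the generating function of the rows with plain parts at most `P` and boxes of contents
`s + 1, …, c`. -/
noncomputable def rowCoeff (x y : ℕ → R) (P c s : ℤ) : R :=
  coeffInt (chernSeries x y P.toNat (P + c).toNat) (c - s)

/-- An entry with plain part `P` in a box of content `c` has primed part `P + c`. -/
theorem isRowGeneratingFunction_rowCoeff (x y : ℕ → R) {L : ℤ} (hL : L ≤ 0) :
    IsRowGeneratingFunction (fun P c => extendZero x P + extendZero y (P + c)) L (-L)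
      (rowCoeff x y) where
  recurrence P c s := by
    unfold rowCoeff
    rw [chernSeries_toNat_eq_add, coeffInt_add, coeffInt_C_mul_mul_X, sub_right_comm c 1 s]
    ring_nf
  lowest c hc s := by
    rw [rowCoeff, Int.toNat_of_nonpos hL, Int.toNat_of_nonpos (by omega), chernSeries_zero_zero,
      coeffInt_one]
    exact if_congr sub_eq_zero rfl rfl
  eq_zero_of_lt _ _ _ hcs := coeffInt_of_neg _ (sub_neg.2 hcs)

theorem schurDet_eq_det_contentMatrix (x y : ℕ → R) {n : ℕ} {p q : Fin n → ℕ} {t : ℤ}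
    {lam mu : Fin n → ℤ} (hlast : ∀ i, content t (i, lam i) = (q i : ℤ) - p i) :
    schurDet (fun i => chernSeries x y (p i) (q i)) lam mu =
      (contentMatrix (rowCoeff x y) t (fun i => p i) lam mu).det := by
  unfold schurDet
  congr 1
  ext k l
  have hflag : (p k : ℤ) + content t (k, lam k) = q k := by
    rw [hlast, add_sub_cancel]
  have hdegree : content t (k, lam k) - content t (l, mu l) =
      lam k - mu l + ((l : ℕ) : ℤ) - ((k : ℕ) : ℤ) := by
    simp only [content]
    ring
  simp only [contentMatrix, rowCoeff, Matrix.of_apply, hflag, hdegree, Int.toNat_natCast]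

end Series

namespace TabEntry

variable {a b c : ℤ} {k l : ℕ} {e : TabEntry}

/-- The entry with plain part `a` and primed part `b`, where a part that is not positive is
absent. At least one of them must be positive, otherwise the value is the meaningless `0'`. -/
def ofParts (a b : ℤ) : TabEntry :=
  if a ≤ 0 then primed b.toNat
  else if b ≤ 0 then plain a.toNat
  else pair a.toNat b.toNat

/-- The plain part of an entry in a box of content `c`, extrapolated from the primed part by
`l - k = c` if it is absent. -/
def index (c : ℤ) : TabEntry → ℤ
  | plain k => k
  | primed l => l - c
  | pair k _ => k

/-- All integers occurring in the entry are positive. -/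
def IsPositive : TabEntry → Prop
  | plain k => 1 ≤ k
  | primed l => 1 ≤ l
  | pair k l => 1 ≤ k ∧ 1 ≤ l

theorem isPositive_of_forall_mem (hplain : ∀ k ∈ e.plainPart, 1 ≤ k)
    (hprimed : ∀ l ∈ e.primedPart, 1 ≤ l) : e.IsPositive :=
  match e with
  | plain k => hplain k rfl
  | primed l => hprimed l rfl
  | pair k l => ⟨hplain k rfl, hprimed l rfl⟩

theorem mem_plainPart_ofParts : k ∈ (ofParts a b).plainPart ↔ 0 < a ∧ (k : ℤ) = a := by
  grind [ofParts, plainPart]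

theorem mem_primedPart_ofParts (h : 0 < a ∨ 0 < b) :
    l ∈ (ofParts a b).primedPart ↔ 0 < b ∧ (l : ℤ) = b := by
  grind [ofParts, primedPart]

theorem isSome_plainPart_ofParts : (ofParts a b).plainPart.isSome ↔ 0 < a := by
  grind [ofParts, plainPart]

theorem isSome_primedPart_ofParts (h : 0 < a ∨ 0 < b) :
    (ofParts a b).primedPart.isSome ↔ 0 < b := by
  grind [ofParts, primedPart]

theorem fitsContent_ofParts (h : 0 < a ∨ 0 < a + c) : (ofParts a (a + c)).FitsContent c := by
  grind [ofParts, FitsContent]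

theorem ofParts_eq_pair_iff :
    ofParts a b = pair k l ↔ 0 < a ∧ 0 < b ∧ (k : ℤ) = a ∧ (l : ℤ) = b := by
  grind [ofParts]

theorem exists_ofParts_eq_pair {a' b' : ℤ} {r s : ℕ} (h : ofParts a b = pair k l)
    (ha : a + r ≤ a') (hb : b' - (b + s) = a' - (a + r)) :
    ∃ m : ℕ, ofParts a' b' = pair (k + m + r) (l + m + s) := by
  have := ofParts_eq_pair_iff.1 h
  exact ⟨(a' - (a + r)).toNat, ofParts_eq_pair_iff.2 (by omega)⟩

theorem index_ofParts (h : 0 < a ∨ 0 < a + c) : (ofParts a (a + c)).index c = a := by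
  grind [ofParts, index]

theorem ofParts_index (hpos : e.IsPositive) (hfit : e.FitsContent c) :
    ofParts (e.index c) (e.index c + c) = e := by
  cases e <;> grind [IsPositive, FitsContent, index, ofParts]

theorem index_pos_or (hpos : e.IsPositive) : 0 < e.index c ∨ 0 < e.index c + c := by
  cases e <;> grind [IsPositive, index]

theorem weight_ofParts {R : Type*} [CommRing R] (x y : ℕ → R) (h : 0 < a ∨ 0 < b) :
    (ofParts a b).weight x y = extendZero x a + extendZero y b := by
  unfold ofParts
  split_ifs with ha hb
  · rw [extendZero_of_nonpos x ha, extendZero_of_pos y (by omega), zero_add, weight]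
  · rw [extendZero_of_nonpos y hb, extendZero_of_pos x (by omega), add_zero, weight]
  · rw [extendZero_of_pos x (by omega), extendZero_of_pos y (by omega), weight]

end TabEntry

section Encoding

open TabEntry

variable {n : ℕ} {p q : Fin n → ℕ} {t : ℤ} {lam mu : Fin n → ℤ} {f : Fin n × ℤ →₀ ℤ}
  {b b' : Fin n × ℤ} {T : Filling lam mu}

/-- The plain part of the entry that `f` encodes in the box `b`; it may fail to be positive. -/
def plainValue (f : Fin n × ℤ →₀ ℤ) (b : Fin n × ℤ) : ℤ :=
  f b + (b.1 : ℕ)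

/-- The primed part of the entry that `f` encodes in the box `b`; it may fail to be positive.
In row number `i` and column `j` the plain part exceeds `f b` by `i - 1` and the primed part by
`j - 1 - t`. -/
def primedValue (t : ℤ) (f : Fin n × ℤ →₀ ℤ) (b : Fin n × ℤ) : ℤ :=
  plainValue f b + content t b

/-- The filling of `lam/mu` encoded by `f`. -/
def decodeFilling (t : ℤ) (lam mu : Fin n → ℤ) (f : Fin n × ℤ →₀ ℤ) : Filling lam mu :=
  fun b => ofParts (plainValue f b) (primedValue t f b)

/-- The integers encoding a filling `T` of `lam/mu`, extended by zero. -/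
noncomputable def encodeFilling (t : ℤ) (T : Filling lam mu) : Fin n × ℤ →₀ ℤ :=
  Finsupp.indicator (skewDiagram lam mu) fun b hb =>
    (T ⟨b, hb⟩).index (content t b) - (b.1 : ℕ)

theorem plainValue_encodeFilling (t : ℤ) (T : Filling lam mu) (hb : b ∈ skewDiagram lam mu) :
    plainValue (encodeFilling t T) b = (T ⟨b, hb⟩).index (content t b) := by
  rw [plainValue, encodeFilling, Finsupp.indicator_of_mem hb, sub_add_cancel]

theorem decodeFilling_encodeFilling (hpos : ∀ b, (T b).IsPositive)
    (hfit : ∀ b, (T b).FitsContent (content t b.1)) :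
    decodeFilling t lam mu (encodeFilling t T) = T := by
  funext b
  rw [decodeFilling, primedValue, plainValue_encodeFilling t T b.2]
  exact ofParts_index (hpos b) (hfit b)

theorem encodeFilling_decodeFilling (hoff : ∀ b ∉ skewDiagram lam mu, f b = 0)
    (hpos : ∀ b ∈ skewDiagram lam mu, 0 < plainValue f b ∨ 0 < primedValue t f b) :
    encodeFilling t (decodeFilling t lam mu f) = f := by
  ext b
  by_cases hb : b ∈ skewDiagram lam mu
  · rw [encodeFilling, Finsupp.indicator_of_mem hb, decodeFilling, primedValue,
      index_ofParts (hpos b hb), plainValue, add_sub_cancel_right]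
  · rw [encodeFilling, Finsupp.indicator_of_notMem hb, hoff b hb]

theorem fillingWeight_decodeFilling {R : Type*} [CommRing R] (x y : ℕ → R)
    (hpos : ∀ b ∈ skewDiagram lam mu, 0 < plainValue f b ∨ 0 < primedValue t f b) :
    fillingWeight x y (decodeFilling t lam mu f) =
      ∏ b ∈ skewDiagram lam mu,
        (extendZero x (plainValue f b) + extendZero y (primedValue t f b)) := by
  rw [← Finset.prod_coe_sort (skewDiagram lam mu), fillingWeight]
  exact Finset.prod_congr rfl fun b _ => weight_ofParts x y (hpos b b.2)

theorem IsTableau.isPositive (hT : IsTableau p q t lam mu T)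
    (b : {b // b ∈ skewDiagram lam mu}) : (T b).IsPositive :=
  isPositive_of_forall_mem (fun k hk => (hT.plain_flag b k hk).1)
    fun l hl => (hT.primed_flag b l hl).1

theorem content_le_content_last (t : ℤ) (hb : b ∈ skewDiagram lam mu) :
    content t b ≤ content t (b.1, lam b.1) :=
  sub_le_sub_right (sub_le_sub_right (mem_skewDiagram.1 hb).2 _) _

/-- Two comparable boxes are joined by a path in the diagram through the box in the row of the
second and the column of the first. -/
theorem monotoneOn_skewDiagram {α : Type*} [Preorder α] {g : Fin n × ℤ → α}
    (hlam : Antitone lam) (hmu : Antitone mu)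
    (hrow : ∀ (i : Fin n) (j : ℤ), (i, j) ∈ skewDiagram lam mu → (i, j + 1) ∈ skewDiagram lam mu →
      g (i, j) ≤ g (i, j + 1))
    (hcol : ∀ (i i' : Fin n) (j : ℤ), (i : ℕ) + 1 = i' → (i, j) ∈ skewDiagram lam mu →
      (i', j) ∈ skewDiagram lam mu → g (i, j) ≤ g (i', j)) :
    MonotoneOn g (skewDiagram lam mu) := by
  have hrow_mono (i) : MonotoneOn (fun j => g (i, j)) (Set.Ioc (mu i) (lam i)) :=
    monotoneOn_of_le_add_one Set.ordConnected_Ioc fun j _ hj hj' =>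
      hrow i j (mem_skewDiagram.2 hj) (mem_skewDiagram.2 hj')
  have hcol_mono (j) : MonotoneOn (fun i => g (i, j)) {i | mu i < j ∧ j ≤ lam i} := by
    refine monotoneOn_of_le_succ ⟨fun i hi i' hi' k hk => ?_⟩ fun i hmax hi hi' =>
      hcol i _ j ?_ (mem_skewDiagram.2 hi) (mem_skewDiagram.2 hi')
    · exact ⟨(hmu hk.1).trans_lt hi.1, hi'.2.trans (hlam hk.2)⟩
    · exact (Nat.covBy_iff_add_one_eq.1 (Fin.covBy_iff.1 (Order.covBy_succ_of_not_isMax hmax)))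
  rintro ⟨i, j⟩ hb ⟨i', j'⟩ hb' ⟨hi : i ≤ i', hj : j ≤ j'⟩
  have hb := mem_skewDiagram.1 hb
  have hb' := mem_skewDiagram.1 hb'
  have hcorner : mu i' < j ∧ j ≤ lam i' := ⟨(hmu hi).trans_lt hb.1, hj.trans hb'.2⟩
  exact (hcol_mono j hb hcorner hi).trans (hrow_mono i' hcorner hb' hj)

theorem plainValue_le_and_primedValue_lt_of_row (t : ℤ) (hf : MonotoneOn f (skewDiagram lam mu))
    (hb : b ∈ skewDiagram lam mu) (hb' : b' ∈ skewDiagram lam mu) (hi : b.1 = b'.1)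
    (hj : b.2 < b'.2) :
    plainValue f b ≤ plainValue f b' ∧ primedValue t f b < primedValue t f b' := by
  have := hf hb hb' ⟨hi.le, hj.le⟩
  simp only [primedValue, plainValue, content, hi]
  omega

theorem plainValue_lt_and_primedValue_le_of_col (t : ℤ) (hf : MonotoneOn f (skewDiagram lam mu))
    (hb : b ∈ skewDiagram lam mu) (hb' : b' ∈ skewDiagram lam mu) (hi : b.1 < b'.1)
    (hj : b.2 = b'.2) :
    plainValue f b < plainValue f b' ∧ primedValue t f b ≤ primedValue t f b' := by
  have := hf hb hb' ⟨hi.le, hj.le⟩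
  have := Fin.lt_def.1 hi
  simp only [primedValue, plainValue, content, hj]
  omega

theorem mem_plainPart_decodeFilling {b : {b // b ∈ skewDiagram lam mu}} {k : ℕ} :
    k ∈ (decodeFilling t lam mu f b).plainPart ↔ 0 < plainValue f b ∧ (k : ℤ) = plainValue f b :=
  mem_plainPart_ofParts

theorem isSome_plainPart_decodeFilling {b : {b // b ∈ skewDiagram lam mu}} :
    (decodeFilling t lam mu f b).plainPart.isSome ↔ 0 < plainValue f b :=
  isSome_plainPart_ofParts

theorem mem_primedPart_decodeFilling {b : {b // b ∈ skewDiagram lam mu}} {l : ℕ}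
    (hpos : 0 < plainValue f b ∨ 0 < primedValue t f b) :
    l ∈ (decodeFilling t lam mu f b).primedPart ↔
      0 < primedValue t f b ∧ (l : ℤ) = primedValue t f b :=
  mem_primedPart_ofParts hpos

theorem isSome_primedPart_decodeFilling {b : {b // b ∈ skewDiagram lam mu}}
    (hpos : 0 < plainValue f b ∨ 0 < primedValue t f b) :
    (decodeFilling t lam mu f b).primedPart.isSome ↔ 0 < primedValue t f b :=
  isSome_primedPart_ofParts hpos

theorem exists_decodeFilling_right_eq_pair {b b' : {b // b ∈ skewDiagram lam mu}}
    (hf : MonotoneOn f (skewDiagram lam mu)) (hi : b.1.1 = b'.1.1) (hj : b.1.2 + 1 = b'.1.2)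
    (k l : ℕ) (hkl : decodeFilling t lam mu f b = pair k l) :
    ∃ m : ℕ, decodeFilling t lam mu f b' = pair (k + m) (l + m + 1) := by
  have hvalue := plainValue_le_and_primedValue_lt_of_row t hf b.2 b'.2 hi (by omega)
  refine exists_ofParts_eq_pair (r := 0) (s := 1) hkl (by omega) ?_
  simp only [primedValue, content, hi]
  omega

theorem exists_decodeFilling_below_eq_pair {b b' : {b // b ∈ skewDiagram lam mu}}
    (hf : MonotoneOn f (skewDiagram lam mu)) (hi : (b.1.1 : ℕ) + 1 = b'.1.1)
    (hj : b.1.2 = b'.1.2) (k l : ℕ) (hkl : decodeFilling t lam mu f b = pair k l) :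
    ∃ m : ℕ, decodeFilling t lam mu f b' = pair (k + m + 1) (l + m) := by
  have hvalue := plainValue_lt_and_primedValue_le_of_col t hf b.2 b'.2
    (Fin.lt_def.2 (by omega)) hj
  refine exists_ofParts_eq_pair (r := 1) (s := 0) hkl (by omega) ?_
  simp only [primedValue, content, hj]
  omega

theorem isTableau_decodeFilling (hlast : ∀ i, content t (i, lam i) = (q i : ℤ) - p i)
    (hf : MonotoneOn f (skewDiagram lam mu))
    (hflag : ∀ b ∈ skewDiagram lam mu, plainValue f b ≤ p b.1)
    (hpos : ∀ b ∈ skewDiagram lam mu, 0 < plainValue f b ∨ 0 < primedValue t f b) :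
    IsTableau p q t lam mu (decodeFilling t lam mu f) := by
  simp only [Subtype.forall'] at hflag hpos
  constructor
  case plain_flag =>
    intro b k hk
    have := hflag b
    rw [mem_plainPart_decodeFilling] at hk
    omega
  case primed_flag =>
    intro b l hl
    have := content_le_content_last t b.2
    have := hlast b.1.1
    have := hflag b
    rw [mem_primedPart_decodeFilling (hpos b), primedValue] at hl
    omega
  case fits => exact fun b => fitsContent_ofParts (hpos b)
  case pair_right => exact fun _ _ => exists_decodeFilling_right_eq_pair hf
  case pair_below => exact fun _ _ => exists_decodeFilling_below_eq_pair hf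
  case plain_right | primed_right | plain_row | primed_row =>
    intro b b' hi hj
    have := plainValue_le_and_primedValue_lt_of_row t hf b.2 b'.2 hi hj
    grind [mem_plainPart_decodeFilling, mem_primedPart_decodeFilling,
      isSome_plainPart_decodeFilling, isSome_primedPart_decodeFilling]
  case plain_below | primed_below | plain_col | primed_col =>
    intro b b' hi hj
    have := plainValue_lt_and_primedValue_le_of_col t hf b.2 b'.2 hi hj
    grind [mem_plainPart_decodeFilling, mem_primedPart_decodeFilling,
      isSome_plainPart_decodeFilling, isSome_primedPart_decodeFilling]

end Encoding

section Decoding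

variable {n : ℕ} {p q : Fin n → ℕ} {t : ℤ} {lam mu : Fin n → ℤ} {f : Fin n × ℤ →₀ ℤ}
  {b b' : {b // b ∈ skewDiagram lam mu}}

theorem toNat_plainValue_mem_plainPart (h : 0 < plainValue f b) :
    (plainValue f b).toNat ∈ (decodeFilling t lam mu f b).plainPart :=
  mem_plainPart_decodeFilling.2 ⟨h, Int.toNat_of_nonneg h.le⟩

theorem toNat_primedValue_mem_primedPart (h : 0 < primedValue t f b) :
    (primedValue t f b).toNat ∈ (decodeFilling t lam mu f b).primedPart :=
  (mem_primedPart_decodeFilling (.inr h)).2 ⟨h, Int.toNat_of_nonneg h.le⟩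

theorem plainValue_le_flag (hT : IsTableau p q t lam mu (decodeFilling t lam mu f))
    (b : {b // b ∈ skewDiagram lam mu}) : plainValue f b ≤ p b.1.1 := by
  rcases le_or_gt (plainValue f b) 0 with hnonpos | hplain
  · omega
  · have := (hT.plain_flag b _ (toNat_plainValue_mem_plainPart hplain)).2
    omega

theorem plainValue_le_of_row (hT : IsTableau p q t lam mu (decodeFilling t lam mu f))
    (hpos : ∀ b ∈ skewDiagram lam mu, 0 < plainValue f b ∨ 0 < primedValue t f b)
    (hi : b.1.1 = b'.1.1) (hj : b.1.2 + 1 = b'.1.2) :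
    plainValue f b ≤ plainValue f b' := by
  have hlt : b.1.2 < b'.1.2 := by omega
  rcases hpos b b.2 with hplain | hprimed
  · have hplain' : 0 < plainValue f b' := isSome_plainPart_decodeFilling.1 <|
      hT.plain_right b b' hi hlt (isSome_plainPart_decodeFilling.2 hplain)
    have := hT.plain_row b b' hi hlt _ (toNat_plainValue_mem_plainPart hplain)
      _ (toNat_plainValue_mem_plainPart hplain')
    omega
  · have hprimed' : 0 < primedValue t f b' :=
      (isSome_primedPart_decodeFilling (hpos b' b'.2)).1 <| hT.primed_right b b' hi hlt <|
        (isSome_primedPart_decodeFilling (hpos b b.2)).2 hprimed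
    have := hT.primed_row b b' hi hlt _ (toNat_primedValue_mem_primedPart hprimed)
      _ (toNat_primedValue_mem_primedPart hprimed')
    simp only [primedValue, content, hi] at this hprimed
    omega

theorem plainValue_lt_of_col (hT : IsTableau p q t lam mu (decodeFilling t lam mu f))
    (hpos : ∀ b ∈ skewDiagram lam mu, 0 < plainValue f b ∨ 0 < primedValue t f b)
    (hi : (b.1.1 : ℕ) + 1 = b'.1.1) (hj : b.1.2 = b'.1.2) :
    plainValue f b < plainValue f b' := by
  have hlt : b.1.1 < b'.1.1 := Fin.lt_def.2 (by omega)
  rcases hpos b b.2 with hplain | hprimed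
  · have hplain' : 0 < plainValue f b' := isSome_plainPart_decodeFilling.1 <|
      hT.plain_below b b' hlt hj (isSome_plainPart_decodeFilling.2 hplain)
    have := hT.plain_col b b' hlt hj _ (toNat_plainValue_mem_plainPart hplain)
      _ (toNat_plainValue_mem_plainPart hplain')
    omega
  · have hprimed' : 0 < primedValue t f b' :=
      (isSome_primedPart_decodeFilling (hpos b' b'.2)).1 <| hT.primed_below b b' hlt hj <|
        (isSome_primedPart_decodeFilling (hpos b b.2)).2 hprimed
    have := hT.primed_col b b' hlt hj _ (toNat_primedValue_mem_primedPart hprimed)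
      _ (toNat_primedValue_mem_primedPart hprimed')
    simp only [primedValue, content, hj] at this hprimed
    omega

theorem monotoneOn_of_isTableau_decodeFilling
    (hT : IsTableau p q t lam mu (decodeFilling t lam mu f))
    (hpos : ∀ b ∈ skewDiagram lam mu, 0 < plainValue f b ∨ 0 < primedValue t f b)
    (hlam : Antitone lam) (hmu : Antitone mu) :
    MonotoneOn f (skewDiagram lam mu) := by
  refine monotoneOn_skewDiagram hlam hmu (fun i j hb hb' => ?_) fun i i' j hi hb hb' => ?_
  · have := plainValue_le_of_row hT hpos (b := ⟨_, hb⟩) (b' := ⟨_, hb'⟩) rfl rfl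
    simpa only [plainValue, add_le_add_iff_right] using this
  · have := plainValue_lt_of_col hT hpos (b := ⟨_, hb⟩) (b' := ⟨_, hb'⟩) hi rfl
    simp only [plainValue] at this
    omega

end Decoding

section Tableaux

variable {R : Type*} [CommRing R] {n : ℕ} {p q : Fin n → ℕ} {C t : ℤ} {lam mu : Fin n → ℤ}
  {f : Fin n × ℤ →₀ ℤ} {T : Filling lam mu}

theorem mem_monotoneFillings_iff_isTableau
    (hlast : ∀ i, content t (i, lam i) = (q i : ℤ) - p i)
    (hlam : Antitone lam) (hmu : Antitone mu) (hC0 : 0 ≤ C) (hC : ∀ i, content t (i, lam i) ≤ C)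
    (hpos : ∀ b ∈ skewDiagram lam mu, 0 < plainValue f b ∨ 0 < primedValue t f b) :
    f ∈ monotoneFillings (skewDiagram lam mu) (rowBound fun _ => -C) (rowBound fun i => p i) ↔
      (∀ b ∉ skewDiagram lam mu, f b = 0) ∧ IsTableau p q t lam mu (decodeFilling t lam mu f) := by
  rw [mem_monotoneFillings]
  refine and_congr_right fun _ => ⟨fun ⟨hbound, hf⟩ => ?_, fun hT => ⟨fun b hb => ⟨?_, ?_⟩, ?_⟩⟩
  · exact isTableau_decodeFilling hlast hf
      (fun b hb => le_sub_iff_add_le.1 (hbound b hb).2) hpos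
  · have := (content_le_content_last t hb).trans (hC b.1)
    have := hpos b hb
    rw [primedValue, plainValue] at this
    rw [rowBound]
    omega
  · exact le_sub_iff_add_le.2 (plainValue_le_flag hT ⟨b, hb⟩)
  · exact monotoneOn_of_isTableau_decodeFilling hT hpos hlam hmu

theorem value_pos_or_of_prod_ne_zero {x y : ℕ → R}
    (h : ∏ b ∈ skewDiagram lam mu,
      (extendZero x (plainValue f b) + extendZero y (primedValue t f b)) ≠ 0) :
    ∀ b ∈ skewDiagram lam mu, 0 < plainValue f b ∨ 0 < primedValue t f b := by
  intro b hb
  contrapose! h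
  exact Finset.prod_eq_zero hb <| by
    rw [extendZero_of_nonpos x h.1, extendZero_of_nonpos y h.2, add_zero]

theorem value_encodeFilling_pos_or (t : ℤ) (hpos : ∀ b, (T b).IsPositive) :
    ∀ b ∈ skewDiagram lam mu,
      0 < plainValue (encodeFilling t T) b ∨ 0 < primedValue t (encodeFilling t T) b := by
  intro b hb
  rw [primedValue, plainValue_encodeFilling t T hb]
  exact TabEntry.index_pos_or (hpos ⟨b, hb⟩)

open Classical in
theorem flaggedSum_eq_sum_fillingWeight (x y : ℕ → R)
    (hlast : ∀ i, content t (i, lam i) = (q i : ℤ) - p i) (hlam : Antitone lam)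
    (hmu : Antitone mu) (hC0 : 0 ≤ C) (hC : ∀ i, content t (i, lam i) ≤ C) :
    flaggedSum (fun P c => extendZero x P + extendZero y (P + c)) (-C) t (fun i => p i) lam mu =
      ∑ T ∈ tableaux p q t lam mu, fillingWeight x y T := by
  have hmem {f} := mem_monotoneFillings_iff_isTableau (f := f) hlast hlam hmu hC0 hC
  have hdecode {T} (hT : T ∈ tableaux p q t lam mu) :
      decodeFilling t lam mu (encodeFilling t T) = T :=
    decodeFilling_encodeFilling (mem_tableaux.1 hT).isPositive (mem_tableaux.1 hT).fits
  change ∑ f ∈ monotoneFillings _ _ _, ∏ b ∈ skewDiagram lam mu,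
    (extendZero x (plainValue f b) + extendZero y (primedValue t f b)) = _
  rw [← Finset.sum_filter_of_ne fun f _ => value_pos_or_of_prod_ne_zero]
  refine Finset.sum_bij' (fun f _ => decodeFilling t lam mu f) (fun T _ => encodeFilling t T)
    (fun f hf => ?_) (fun T hT => ?_) (fun f hf => ?_) (fun T hT => hdecode hT) fun f hf => ?_
  · rw [Finset.mem_filter] at hf
    exact mem_tableaux.2 ((hmem hf.2).1 hf.1).2
  · have hpos := value_encodeFilling_pos_or t (mem_tableaux.1 hT).isPositive
    refine Finset.mem_filter.2 ⟨(hmem hpos).2 ⟨fun b hb => ?_, ?_⟩, hpos⟩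
    · exact Finsupp.indicator_of_notMem hb _
    · rw [hdecode hT]
      exact mem_tableaux.1 hT
  · rw [Finset.mem_filter] at hf
    exact encodeFilling_decodeFilling ((hmem hf.2).1 hf.1).1 hf.2
  · exact (fillingWeight_decodeFilling x y (Finset.mem_filter.1 hf).2).symm

theorem antitone_of_flags (hp : Monotone p) (hq : Antitone q)
    (hstrict : ∀ i j : Fin n, (i : ℕ) + 1 = j → p i < p j ∨ q j < q i)
    (hlam : ∀ i, lam i = (q i : ℤ) - p i + ((i : ℕ) + 1) + t) : Antitone lam := by
  rcases n with _ | n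
  · exact fun i => i.elim0
  refine Fin.antitone_iff_succ_le.2 fun i => ?_
  have := hstrict i.castSucc i.succ (by simp)
  have := hp i.castSucc_le_succ
  have := hq i.castSucc_le_succ
  rw [hlam, hlam, Fin.val_castSucc, Fin.val_succ]
  omega

end Tableaux

theorem mainTheorem4_general {R : Type*} [CommRing R] (x y : ℕ → R) {n : ℕ} (p q : Fin n → ℕ)
    (hp : Monotone p) (t : ℤ) (lam mu : Fin n → ℤ)
    (hlam : ∀ i : Fin n, lam i = (q i : ℤ) - (p i : ℤ) + (((i : ℕ) : ℤ) + 1) + t)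
    (hlam_anti : Antitone lam) (hmu : Antitone mu) (hle : ∀ i, mu i ≤ lam i) :
    schurDet (fun i => chernSeries x y (p i) (q i)) lam mu =
      ∑ T ∈ tableaux p q t lam mu, fillingWeight x y T := by
  let C : ℤ := ((∑ i, q i : ℕ) : ℤ)
  have hlast (i) : content t (i, lam i) = (q i : ℤ) - p i := by
    rw [content, hlam]
    ring
  have hC (i) : content t (i, lam i) ≤ C := by
    have := Finset.single_le_sum (fun j _ => Nat.zero_le (q j)) (Finset.mem_univ i)
    rw [hlast]
    omega
  have hC0 : 0 ≤ C := Int.natCast_nonneg _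
  have hL (i) : -C ≤ (p i : ℤ) := by omega
  rw [schurDet_eq_det_contentMatrix x y hlast,
    det_contentMatrix_eq_flaggedSum (isRowGeneratingFunction_rowCoeff x y (neg_nonpos.2 hC0))
      (fun _ _ h => Nat.cast_le.2 (hp h)) hlam_anti hmu hle hL (by simpa only [neg_neg] using hC),
    flaggedSum_eq_sum_fillingWeight x y hlast hlam_anti hmu hC0 hC]

theorem mainTheorem4 {R : Type*} [CommRing R] (x y : ℕ → R) {n : ℕ} (p q : Fin n → ℕ)
    (hp : Monotone p) (hq : Antitone q)
    (hstrict : ∀ i j : Fin n, (i : ℕ) + 1 = (j : ℕ) → p i < p j ∨ q j < q i)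
    (t : ℤ) (lam mu : Fin n → ℤ)
    (hlam : ∀ i : Fin n, lam i = (q i : ℤ) - (p i : ℤ) + (((i : ℕ) : ℤ) + 1) + t)
    (hmu : Antitone mu) (hle : ∀ i, mu i ≤ lam i) :
    schurDet (fun i => chernSeries x y (p i) (q i)) lam mu =
      ∑ T ∈ tableaux p q t lam mu, fillingWeight x y T :=
  mainTheorem4_general x y p q hp t lam mu hlam (antitone_of_flags hp hq hstrict hlam) hmu hle
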